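/- Let $\mathcal H$ be a complex Hilbert space of finite dimension $d$ (e.g. $\mathbb C^d$). For $x\in\mathcal H$ let $x\otimes x$ be the operator $z\mapsto\langle z,x\rangle x$, and for a finite sequence $\mathcal W=(w_i)_i$ in $\mathcal H$ let $S_{\mathcal W}=\sum_i w_i\otimes w_i$ be its frame operator. Let $\mathcal F_0=(f_i)_{i=1}^{n_0}$ be a finite sequence in $\mathcal H$ and let $\alpha_1,\dots,\alpha_k>0$, with $d-\operatorname{rank}S_{\mathcal F_0}\le k$. Let $\mathcal F=(\mathcal F_0,\mathcal G)=(f_i)_{i=1}^{n}$, $n=n_0+k$, be a completion of $\mathcal F_0$ by $\mathcal G=(f_{n_0+i})_{i=1}^k$ with $\|f_{n_0+i}\|^2=\alpha_i$ for $1\le i\le k$. Put $\mathcal R=\operatorname{span}\mathcal G$ and $\tau=\sum_{i=1}^k\alpha_i$. Let $\mathcal H_d(\mathcal R)^\tau$ be the real affine space of self-adjoint operators $S$ on $\mathcal H$ with range contained in $\mathcal R$ and $\operatorname{tr}S=\tau$, let $\mathcal U(\mathcal R)$ be the unitary group of $\mathcal R$ with its usual smooth structure, $I^k=(I,\dots,I)\in\mathcal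 U(\mathcal R)^k$, and let $$\Psi_{\mathcal F}:\mathcal U(\mathcal R)^k\to S_{\mathcal F_0}+\mathcal H_d(\mathcal R)^\tau,\qquad \Psi_{\mathcal F}(U_1,\dots,U_k)=S_{\mathcal F_0}+\sum_{i=1}^k U_if_{n_0+i}\otimes U_if_{n_0+i}.$$ Then $\Psi_{\mathcal F}$ is a well-defined smooth map with $\Psi_{\mathcal F}(I^k)=S_{\mathcal F}$, and the following are equivalent: 1. $\Psi_{\mathcal F}$ is a submersion at $I^k$ (its differential at $I^k$ is surjective). 2. $\mathcal G$ is irreducible, i.e. it cannot be partitioned into two nonempty mutually orthogonal subsequences. In this case, the image of $\Psi_{\mathcal F}$ contains an open neighborhood of $S_{\mathcal F}$ in $S_{\mathcal F_0}+\mathcal H_d(\mathcal R)^\tau$, and $\Psi_{\mathcal F}$ has a smooth local cross section around $S_{\mathcal F}$: there are an open neighborhood $N$ of $S_{\mathcal F}$ in $S_{\mathcal F_0}+\mathcal H_d(\mathcal R)^\tau$ and a smooth map $\psi:N\to\mathcal U(\mathcal R)^k$ with $\Psi_{\mathcal F}(\psi(S))=S$ for all $S\in N$ and $\psi(S_{\mathcal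 F})=I^k$. -/

import Mathlib

open Set Filter Topology Manifold
open scoped ContDiff InnerProductSpace

noncomputable section

/-! ## The unitary group of a normed star algebra as a manifold

The unitary group is modelled on the real vector space of skew-adjoint elements (its Lie algebra).
The chart at `U` is the left translate by `U` of the Cayley chart
`W ↦ (W - 1) (W + 1)⁻¹` at the identity. -/

namespace UnitaryManifold

section Algebra

variable {A : Type*} [Ring A] [StarRing A]

/-- The Cayley transform `X ↦ (1 + X) (1 - X)⁻¹`. -/
def cayley (X : A) : A := (1 + X) * Ring.inverse (1 - X)

/-- The inverse of the Cayley transform, `W ↦ (W - 1) (W + 1)⁻¹`. -/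
def cayleyInv (W : A) : A := (W - 1) * Ring.inverse (W + 1)

theorem cayley_mem_unitary {X : A} (hX : X ∈ skewAdjoint A) (h : IsUnit (1 - X)) :
    cayley X ∈ unitary A := by
  have hX' : star X = -X := skewAdjoint.mem_iff.1 hX
  obtain ⟨u, hu⟩ := h
  have hs : 1 + X = star (u : A) := by rw [hu]; simp [hX']
  have hc : Commute (u : A) (star (u : A)) := by
    rw [← hs, hu]
    exact ((Commute.one_left (1 + X)).sub_left
      ((Commute.one_right X).add_right (Commute.refl X)))
  have hcay : cayley X = ((star u * u⁻¹ : Aˣ) : A) := by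
    simp [cayley, hs, ← hu]
  have hcu : Commute u (star u) := by
    apply Units.ext
    simpa using hc.eq
  have e1 : star u * u⁻¹ = u⁻¹ * star u := (hcu.symm.inv_right).eq
  rw [hcay, Unitary.mem_iff, ← Units.coe_star, ← Units.val_mul, ← Units.val_mul]
  constructor
  · rw [← Units.val_one, Units.val_inj]
    simp only [star_mul, star_star, star_inv]
    rw [mul_assoc, ← mul_assoc u, hcu.eq, mul_assoc, mul_inv_cancel, mul_one, inv_mul_cancel]
  · rw [← Units.val_one, Units.val_inj]
    simp only [star_mul, star_star, star_inv]
    rw [e1, mul_assoc, ← mul_assoc (star u), mul_inv_cancel, one_mul, inv_mul_cancel]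

theorem cayleyInv_mem_skewAdjoint {W : A} (hW : W ∈ unitary A) (h : IsUnit (W + 1)) :
    cayleyInv W ∈ skewAdjoint A := by
  rw [skewAdjoint.mem_iff]
  obtain ⟨u, hu⟩ := h
  have h1 : star W * W = 1 := Unitary.star_mul_self_of_mem hW
  have h2 : W * star W = 1 := Unitary.mul_star_self_of_mem hW
  have hc : cayleyInv W = (W - 1) * ((u⁻¹ : Aˣ) : A) := by simp [cayleyInv, ← hu]
  have hs : star ((u⁻¹ : Aˣ) : A) = ((u⁻¹ : Aˣ) : A) * W := by
    have a1 : star (u : A) = star W * u := by rw [hu]; simp [mul_add, h1, add_comm]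
    have a2 : star ((u⁻¹ : Aˣ) : A) * star (u : A) = 1 := by
      rw [← star_mul]; simp
    have a3 : star ((u⁻¹ : Aˣ) : A) * star W = ((u⁻¹ : Aˣ) : A) := by
      rw [(Units.eq_mul_inv_iff_mul_eq u).2 (show star ((u⁻¹ : Aˣ) : A) * star W * u = 1 by
        rw [mul_assoc, ← a1, a2]), one_mul]
    calc star ((u⁻¹ : Aˣ) : A) = star ((u⁻¹ : Aˣ) : A) * star W * W := by
          rw [mul_assoc, h1, mul_one]
      _ = _ := by rw [a3]
  have hcomm : ((u⁻¹ : Aˣ) : A) * (W - 1) = (W - 1) * ((u⁻¹ : Aˣ) : A) := by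
    have : Commute (u : A) (W - 1) := by
      rw [hu]
      exact (((Commute.refl W).sub_right (Commute.one_right W)).add_left (Commute.one_left _))
    exact (this.units_inv_left).eq
  rw [hc, star_mul, hs, star_sub, star_one, mul_assoc, mul_sub, h2, mul_one, ← hcomm,
    ← mul_neg, neg_sub]

theorem cayleyInv_cayley (two : IsUnit (2 : A)) {X : A} (h : IsUnit (1 - X)) :
    IsUnit (cayley X + 1) ∧ cayleyInv (cayley X) = X := by
  obtain ⟨t, ht⟩ := two
  obtain ⟨u, hu⟩ := h
  have hc : cayley X = (1 + X) * ((u⁻¹ : Aˣ) : A) := by simp [cayley, ← hu]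
  have hone : (1 : A) = (1 - X) * ((u⁻¹ : Aˣ) : A) := by rw [← hu]; simp
  have hp : cayley X + 1 = 2 * ((u⁻¹ : Aˣ) : A) := by
    rw [hc]; nth_rw 2 [hone]; rw [← add_mul]; congr 1; rw [← one_add_one_eq_two]; abel
  have hm : cayley X - 1 = 2 * X * ((u⁻¹ : Aˣ) : A) := by
    rw [hc]; nth_rw 2 [hone]; rw [← sub_mul]; congr 1; rw [two_mul]; abel
  have hp' : cayley X + 1 = ((t * u⁻¹ : Aˣ) : A) := by
    rw [hp]; simp [ht]
  refine ⟨hp' ▸ Units.isUnit _, ?_⟩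
  have h2 : Commute (2 : A) X := by
    rw [← one_add_one_eq_two]
    exact (Commute.one_left X).add_left (Commute.one_left X)
  rw [cayleyInv, hm, hp', Ring.inverse_unit, mul_inv_rev, inv_inv, Units.val_mul,
    mul_assoc, ← mul_assoc _ (u : A), Units.inv_mul, one_mul, h2.eq, mul_assoc]
  rw [← ht, Units.mul_inv, mul_one]

theorem cayley_cayleyInv (two : IsUnit (2 : A)) {W : A} (h : IsUnit (W + 1)) :
    IsUnit (1 - cayleyInv W) ∧ cayley (cayleyInv W) = W := by
  obtain ⟨t, ht⟩ := two
  obtain ⟨u, hu⟩ := h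
  have hc : cayleyInv W = (W - 1) * ((u⁻¹ : Aˣ) : A) := by simp [cayleyInv, ← hu]
  have hone : (1 : A) = (W + 1) * ((u⁻¹ : Aˣ) : A) := by rw [← hu]; simp
  have hm : 1 - cayleyInv W = 2 * ((u⁻¹ : Aˣ) : A) := by
    rw [hc]; nth_rw 1 [hone]; rw [← sub_mul]; congr 1; rw [← one_add_one_eq_two]; abel
  have hp : 1 + cayleyInv W = 2 * W * ((u⁻¹ : Aˣ) : A) := by
    rw [hc]; nth_rw 1 [hone]; rw [← add_mul]; congr 1; rw [two_mul]; abel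
  have hm' : 1 - cayleyInv W = ((t * u⁻¹ : Aˣ) : A) := by
    rw [hm]; simp [ht]
  refine ⟨hm' ▸ Units.isUnit _, ?_⟩
  have h2 : Commute (2 : A) W := by
    rw [← one_add_one_eq_two]
    exact (Commute.one_left W).add_left (Commute.one_left W)
  rw [cayley, hp, hm', Ring.inverse_unit, mul_inv_rev, inv_inv, Units.val_mul,
    mul_assoc, ← mul_assoc _ (u : A), Units.inv_mul, one_mul, h2.eq, mul_assoc]
  rw [← ht, Units.mul_inv, mul_one]

end Algebra

theorem isUnit_two {A : Type*} [Ring A] [Algebra ℝ A] : IsUnit (2 : A) := by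
  have h : IsUnit (algebraMap ℝ A 2) := (IsUnit.mk0 (2 : ℝ) two_ne_zero).map _
  rwa [map_ofNat] at h

section Manifold

variable {A : Type*} [NormedRing A] [NormedAlgebra ℝ A] [CompleteSpace A] [StarRing A]
  [ContinuousStar A] [StarModule ℝ A]

variable (A) in
/-- The real normed space of skew-adjoint elements: the Lie algebra of the unitary group. -/
abbrev LieAlg : Type _ := skewAdjoint.submodule ℝ A

/-- The skew-adjoint part as a continuous linear map. -/
def skewPart : A →L[ℝ] LieAlg A where
  toFun x := ⟨(2⁻¹ : ℝ) • (x - star x), by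
    change _ ∈ skewAdjoint A
    rw [skewAdjoint.mem_iff]; simp [← smul_neg]⟩
  map_add' x y := by ext; simp [← smul_add]; abel_nf
  map_smul' r x := by
    ext
    simp [← smul_sub, smul_comm r]
  cont := by fun_prop

theorem skewPart_of_mem {x : A} (hx : x ∈ skewAdjoint A) : (skewPart x : A) = x := by
  have : star x = -x := skewAdjoint.mem_iff.1 hx
  change (2⁻¹ : ℝ) • (x - star x) = x
  rw [this, sub_neg_eq_add, ← two_smul ℝ x, smul_smul]; norm_num

open Classical in
/-- The Cayley transform as a map from skew-adjoint to unitary elements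
(with the junk value `1` where `1 - X` is not invertible). -/
def cayleyUnitary (X : LieAlg A) : unitary A :=
  if h : IsUnit (1 - (X : A)) then ⟨cayley (X : A), cayley_mem_unitary X.2 h⟩ else 1

theorem coe_cayleyUnitary {X : LieAlg A} (h : IsUnit (1 - (X : A))) :
    (cayleyUnitary X : A) = cayley (X : A) := by
  simp [cayleyUnitary, h]

theorem contDiffAt_inverse {a : A} (h : IsUnit a) : ContDiffAt ℝ ω (Ring.inverse : A → A) a := by
  obtain ⟨u, rfl⟩ := h
  exact contDiffAt_ringInverse ℝ u

theorem contDiffAt_cayley {X : A} (h : IsUnit (1 - X)) : ContDiffAt ℝ ω (cayley : A → A) X := by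
  unfold cayley
  exact (contDiffAt_const.add contDiffAt_id).mul
    (ContDiffAt.comp X (contDiffAt_inverse h) (contDiffAt_const.sub contDiffAt_id))

theorem contDiffAt_cayleyInv {W : A} (h : IsUnit (W + 1)) :
    ContDiffAt ℝ ω (cayleyInv : A → A) W := by
  unfold cayleyInv
  exact (contDiffAt_id.sub contDiffAt_const).mul
    (ContDiffAt.comp W (contDiffAt_inverse h) (contDiffAt_id.add contDiffAt_const))

/-- The chart at `U`: `V ↦ (W - 1) (W + 1)⁻¹` with `W = U⁻¹ V`, defined where `W + 1` is
invertible; its inverse is `X ↦ U (1 + X) (1 - X)⁻¹`. (Where `W + 1` is invertible, the element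
`(W - 1) (W + 1)⁻¹` is skew-adjoint, so that `skewPart` does not change it.) -/
def chart (U : unitary A) : OpenPartialHomeomorph (unitary A) (LieAlg A) where
  toFun V := skewPart (cayleyInv (star (U : A) * (V : A)))
  invFun X := U * cayleyUnitary X
  source := {V | IsUnit (star (U : A) * (V : A) + 1)}
  target := {X | IsUnit (1 - (X : A))}
  map_source' V hV := by
    have hW : star (U : A) * (V : A) ∈ unitary A := (star U * V).2
    change IsUnit (1 - _)
    rw [skewPart_of_mem (cayleyInv_mem_skewAdjoint hW hV)]
    exact (cayley_cayleyInv isUnit_two hV).1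
  map_target' X hX := by
    change IsUnit (_ + 1)
    rw [Submonoid.coe_mul, coe_cayleyUnitary hX, ← mul_assoc, Unitary.coe_star_mul_self, one_mul]
    exact (cayleyInv_cayley isUnit_two hX).1
  left_inv' V hV := by
    have hW : star (U : A) * (V : A) ∈ unitary A := (star U * V).2
    have hs := skewPart_of_mem (cayleyInv_mem_skewAdjoint hW hV)
    apply Subtype.ext
    rw [Submonoid.coe_mul, coe_cayleyUnitary (by rw [hs]; exact (cayley_cayleyInv isUnit_two hV).1), hs,
      (cayley_cayleyInv isUnit_two hV).2, ← mul_assoc,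
      Unitary.mul_star_self_of_mem U.2, one_mul]
  right_inv' X hX := by
    apply Subtype.ext
    rw [Submonoid.coe_mul, coe_cayleyUnitary hX, ← mul_assoc, Unitary.coe_star_mul_self, one_mul,
      (cayleyInv_cayley isUnit_two hX).2]
    exact skewPart_of_mem X.2
  open_source := Units.isOpen.preimage
    ((continuous_const.mul continuous_subtype_val).add continuous_const)
  open_target := Units.isOpen.preimage (continuous_const.sub continuous_subtype_val)
  continuousOn_toFun := fun V hV => by
    refine (skewPart.continuous.continuousAt.comp ?_).continuousWithinAt
    exact ContinuousAt.comp (f := fun V : unitary A => star (U : A) * (V : A))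
      (contDiffAt_cayleyInv hV).continuousAt
      (continuous_const.mul continuous_subtype_val).continuousAt
  continuousOn_invFun := by
    rw [continuousOn_iff_continuous_domRestrict, continuous_induced_rng]
    rw [continuous_iff_continuousAt]
    rintro ⟨X, hX⟩
    have he : (Subtype.val ∘ {X : LieAlg A | IsUnit (1 - (X : A))}.domRestrict
        (fun X => U * cayleyUnitary X)) = fun X => (U : A) * cayley (X.1 : A) := by
      funext Y
      simp only [Function.comp, Set.domRestrict_apply, Submonoid.coe_mul]
      rw [coe_cayleyUnitary Y.2]
    rw [he]
    refine ContinuousAt.mul continuousAt_const ?_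
    exact ContinuousAt.comp (x := (⟨X, hX⟩ : {X : LieAlg A | IsUnit (1 - (X : A))}))
      (f := fun X : {X : LieAlg A | IsUnit (1 - (X : A))} => (X.1 : A))
      (contDiffAt_cayley hX).continuousAt
      (continuous_subtype_val.comp continuous_subtype_val).continuousAt

instance instChartedSpace : ChartedSpace (LieAlg A) (unitary A) where
  atlas := range chart
  chartAt U := chart U
  mem_chart_source U := by
    change IsUnit (star (U : A) * (U : A) + 1)
    rw [Unitary.coe_star_mul_self, one_add_one_eq_two]
    exact isUnit_two
  chart_mem_atlas U := mem_range_self U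

instance instIsManifold : IsManifold 𝓘(ℝ, LieAlg A) ω (unitary A) := by
  apply isManifold_of_contDiffOn
  rintro _ _ ⟨U, rfl⟩ ⟨V, rfl⟩
  have hcd : ∀ X : LieAlg A, X ∈ (chart U).target →
      (chart U).symm X ∈ (chart V).source →
      ContDiffAt ℝ ω (fun X : LieAlg A =>
        skewPart (cayleyInv (star (V : A) * ((U : A) * cayley (X : A))))) X := by
    intro X hX hV
    have hX' : IsUnit (1 - (X : A)) := hX
    have hV' : IsUnit (star (V : A) * ((U : A) * cayley (X : A)) + 1) := by
      rw [← coe_cayleyUnitary hX']; exact hV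
    refine (ContinuousLinearMap.contDiff (E := A) (F := LieAlg A) skewPart).contDiffAt.comp X ?_
    refine ContDiffAt.comp (f := fun X : LieAlg A => star (V : A) * ((U : A) * cayley (X : A)))
      X (contDiffAt_cayleyInv hV') ?_
    refine contDiffAt_const.mul (contDiffAt_const.mul ?_)
    exact ContDiffAt.comp (f := fun X : LieAlg A => (X : A)) X (contDiffAt_cayley hX')
      (skewAdjoint.submodule ℝ A).subtypeL.contDiff.contDiffAt
  intro X hX
  simp only [mfld_simps] at hX
  obtain ⟨hX1, hX2⟩ := hX
  refine (((hcd X hX1 hX2).contDiffWithinAt (s := univ)).mono (subset_univ _)).congr_of_mem ?_ ?_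
  · intro Y hY
    simp only [mfld_simps] at hY
    change skewPart (cayleyInv (star (V : A) * ((U * cayleyUnitary Y : unitary A) : A))) = _
    rw [Submonoid.coe_mul, coe_cayleyUnitary hY.1]
  · simp only [mfld_simps]; exact ⟨hX1, hX2⟩

end Manifold

end UnitaryManifold

/-! ## Finite products of manifolds modelled on normed spaces -/

instance instIsManifoldPi {ι : Type*} [Fintype ι] {E : Type*} [NormedAddCommGroup E]
    [NormedSpace ℝ E] {M : Type*} [TopologicalSpace M] [ChartedSpace E M]
    [IsManifold 𝓘(ℝ, E) ∞ M] :
    IsManifold (ModelWithCorners.pi fun _ : ι => 𝓘(ℝ, E)) ∞ (ι → M) := by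
  apply isManifold_of_contDiffOn
  rintro _ _ ⟨e, he, rfl⟩ ⟨e', he', rfl⟩
  rw [contDiffOn_pi]
  intro i
  have h := (contDiffGroupoid ∞ 𝓘(ℝ, E)).compatible (he i (mem_univ i)) (he' i (mem_univ i))
  rw [contDiffGroupoid, mem_groupoid_of_pregroupoid] at h
  have h1 : ContDiffOn ℝ ∞ ((e i).symm ≫ₕ e' i) ((e i).symm ≫ₕ e' i).source := by
    simpa [contDiffPregroupoid] using h.1
  refine h1.comp (f := fun x : ι → E => x i) (contDiff_apply ℝ E i).contDiffOn ?_
  intro x hx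
  have hx' := hx.1
  simp [ModelWithCorners.pi] at hx' ⊢
  exact ⟨hx'.1 i (mem_univ i), hx'.2 i⟩

/-! ## Affine subspaces as manifolds -/

namespace AffineSubspaceManifold

variable {V : Type*} [NormedAddCommGroup V] [NormedSpace ℝ V] (s : AffineSubspace ℝ V)

/-- The global chart `x ↦ x - p` of an affine subspace, with values in its direction. -/
def homeo (p : s) : s ≃ₜ s.direction where
  toFun x := ⟨(x : V) - p, AffineSubspace.vsub_mem_direction x.2 p.2⟩
  invFun v := ⟨(v : V) + p, AffineSubspace.vadd_mem_of_mem_direction v.2 p.2⟩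
  left_inv x := by ext; simp
  right_inv v := by ext; simp
  continuous_toFun := by fun_prop
  continuous_invFun := by fun_prop

instance instChartedSpace : ChartedSpace s.direction s where
  atlas := range fun p => (homeo s p).toOpenPartialHomeomorph
  chartAt p := (homeo s p).toOpenPartialHomeomorph
  mem_chart_source p := mem_univ p
  chart_mem_atlas p := mem_range_self p

instance instIsManifold : IsManifold 𝓘(ℝ, s.direction) ω s := by
  apply isManifold_of_contDiffOn
  rintro _ _ ⟨p, rfl⟩ ⟨q, rfl⟩
  have : ContDiff ℝ ω fun v : s.direction =>
      v + (⟨(p : V) - q, AffineSubspace.vsub_mem_direction p.2 q.2⟩ : s.direction) :=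
    contDiff_id.add contDiff_const
  refine this.contDiffOn.congr ?_
  intro v _
  apply Subtype.ext
  change (v : V) + p - q = v + (p - q)
  abel

end AffineSubspaceManifold


/-- A map between manifolds is a submersion at `x` if it is differentiable at `x` and its
differential at `x` is surjective. -/
def IsSubmersionAtPoint {E E' H H' M N : Type*} [NormedAddCommGroup E] [NormedSpace ℝ E]
    [NormedAddCommGroup E'] [NormedSpace ℝ E'] [TopologicalSpace H] [TopologicalSpace H']
    [TopologicalSpace M] [ChartedSpace H M] [TopologicalSpace N] [ChartedSpace H' N]
    (I : ModelWithCorners ℝ E H) (J : ModelWithCorners ℝ E' H') (f : M → N) (x : M) : Prop :=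
  MDifferentiableAt I J f x ∧ Function.Surjective (mfderiv I J f x)

/-! ## Frame completions

Throughout, `H` is a finite-dimensional complex Hilbert space, of dimension `d`
(e.g. `EuclideanSpace ℂ (Fin d)`). -/

namespace FrameCompletion

/-- The algebra of linear operators on `H`. -/
abbrev Op (H : Type*) [NormedAddCommGroup H] [InnerProductSpace ℂ H] : Type _ := H →L[ℂ] H

/-- The unitary group of `H`. -/
abbrev UGroup (H : Type*) [NormedAddCommGroup H] [InnerProductSpace ℂ H]
    [FiniteDimensional ℂ H] : Type _ := unitary (Op H)

/-- The model of the manifold `U(H)^k`. -/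
abbrev modelU (H : Type*) [NormedAddCommGroup H] [InnerProductSpace ℂ H]
    [FiniteDimensional ℂ H] (k : ℕ) :
    ModelWithCorners ℝ (Fin k → UnitaryManifold.LieAlg (Op H))
      (ModelPi fun _ : Fin k => UnitaryManifold.LieAlg (Op H)) :=
  ModelWithCorners.pi fun _ : Fin k => 𝓘(ℝ, UnitaryManifold.LieAlg (Op H))

instance instIsManifoldUGroup (H : Type*) [NormedAddCommGroup H] [InnerProductSpace ℂ H]
    [FiniteDimensional ℂ H] :
    IsManifold 𝓘(ℝ, UnitaryManifold.LieAlg (Op H)) ∞ (UGroup H) :=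
  IsManifold.of_le (n := ω) le_top

instance instIsManifoldUGroupPow (H : Type*) [NormedAddCommGroup H] [InnerProductSpace ℂ H]
    [FiniteDimensional ℂ H] (k : ℕ) : IsManifold (modelU H k) ∞ (Fin k → UGroup H) :=
  instIsManifoldPi

variable {H : Type*} [NormedAddCommGroup H] [InnerProductSpace ℂ H] [FiniteDimensional ℂ H]
variable {n₀ k m : ℕ}

/-- The operator `f ⊗ f : z ↦ ⟨z, f⟩ f`, where the inner product of the formula is linear in its
first argument (Mathlib's one is linear in the second argument). -/
def tensorSelf (f : H) : Op H := InnerProductSpace.rankOne ℂ f f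

/-- The frame operator `S_F = ∑ f_i ⊗ f_i`. -/
def frameOp (f : Fin m → H) : Op H := ∑ i, tensorSelf (f i)

/-- Initial data for the completion problem: the prescribed squared norms are positive and
`d - rank S_{F₀} ≤ k`, where `d = dim H`. -/
def IsInitialData (F₀ : Fin n₀ → H) (a : Fin k → ℝ) : Prop :=
  (∀ i, 0 < a i) ∧ Module.finrank ℂ H ≤ k + Module.finrank ℂ (frameOp F₀).range

/-- The second part `G` of a sequence `F = (F₀, G)`. -/
def tail (F : Fin (n₀ + k) → H) : Fin k → H := fun i => F (Fin.natAdd n₀ i)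

/-- The completions `F = (F₀, G)` of `F₀` such that the `i`-th vector of `G` has squared
norm `a i`. -/
def completions (F₀ : Fin n₀ → H) (a : Fin k → ℝ) : Set (Fin (n₀ + k) → H) :=
  {F | (∀ i : Fin n₀, F (Fin.castAdd k i) = F₀ i) ∧ ∀ i : Fin k, ‖tail F i‖ ^ 2 = a i}

/-- A sequence is irreducible if it cannot be partitioned into two (nonempty) mutually
orthogonal subsequences. -/
def IsIrreducibleSeq (g : Fin m → H) : Prop :=
  ¬ ∃ J : Set (Fin m), J.Nonempty ∧ Jᶜ.Nonempty ∧ ∀ i ∈ J, ∀ j ∈ Jᶜ, inner ℂ (g i) (g j) = 0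

/-- The space `H_d(R)^τ` of self-adjoint operators on `H` with range in `R` and trace `τ`,
as a real affine subspace of the space of operators. -/
def hermAffine (R : Submodule ℂ H) (τ : ℝ) : AffineSubspace ℝ (Op H) where
  carrier := {S | IsSelfAdjoint S ∧ S.range ≤ R ∧ LinearMap.trace ℂ H S = (τ : ℂ)}
  smul_vsub_vadd_mem' c S₁ S₂ S₃ h₁ h₂ h₃ := by
    refine ⟨?_, ?_, ?_⟩
    · exact ((IsSelfAdjoint.all c).smul (h₁.1.sub h₂.1)).add h₃.1
    · rintro _ ⟨x, rfl⟩
      have e₁ : S₁ x ∈ R := h₁.2.1 ⟨x, rfl⟩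
      have e₂ : S₂ x ∈ R := h₂.2.1 ⟨x, rfl⟩
      have e₃ : S₃ x ∈ R := h₃.2.1 ⟨x, rfl⟩
      change (c : ℂ) • (S₁ x - S₂ x) + S₃ x ∈ R
      exact R.add_mem (R.smul_mem _ (R.sub_mem e₁ e₂)) e₃
    · change LinearMap.trace ℂ H ((c : ℂ) • ((S₁ : H →ₗ[ℂ] H) - S₂) + S₃) = (τ : ℂ)
      rw [map_add, map_smul, map_sub, h₁.2.2, h₂.2.2, h₃.2.2]
      simp

/-- The affine manifold `S₀ + H_d(R)^τ`. -/
def shiftedHermAffine (S₀ : Op H) (R : Submodule ℂ H) (τ : ℝ) : AffineSubspace ℝ (Op H) where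
  carrier := {T | ∃ S ∈ hermAffine R τ, T = S₀ + S}
  smul_vsub_vadd_mem' := by
    rintro c _ _ _ ⟨S₁, h₁, rfl⟩ ⟨S₂, h₂, rfl⟩ ⟨S₃, h₃, rfl⟩
    refine ⟨_, (hermAffine R τ).smul_vsub_vadd_mem c h₁ h₂ h₃, ?_⟩
    simp only [vsub_eq_sub, vadd_eq_add, add_sub_add_left_eq_sub]
    abel

/-- The span `R` of `G`, for `F = (F₀, G)`. -/
def tailSpan (F : Fin (n₀ + k) → H) : Submodule ℂ H := Submodule.span ℂ (range (tail F))

/-- The vectors of `G`, as elements of `R = span G`. -/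
def tailVec (F : Fin (n₀ + k) → H) (i : Fin k) : tailSpan F :=
  ⟨tail F i, Submodule.subset_span (mem_range_self i)⟩

/-- The operator `∑ U_i f_i ⊗ U_i f_i` on `H`, the sum being over the vectors of `G`. -/
def rotatedFrameOp (F : Fin (n₀ + k) → H) (V : Fin k → UGroup (tailSpan F)) : Op H :=
  ∑ i, tensorSelf (((V i : Op (tailSpan F)) (tailVec F i) : tailSpan F) : H)

theorem rotatedFrameOp_mem {F₀ : Fin n₀ → H} {a : Fin k → ℝ} {F : Fin (n₀ + k) → H}
    (hF : F ∈ completions F₀ a) (V : Fin k → UGroup (tailSpan F)) :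
    rotatedFrameOp F V ∈ hermAffine (tailSpan F) (∑ i, a i) := by
  refine ⟨?_, ?_, ?_⟩
  · unfold rotatedFrameOp tensorSelf
    exact isSelfAdjoint_sum _ fun i _ => (InnerProductSpace.isPositive_rankOne_self _).isSelfAdjoint
  · rintro _ ⟨x, rfl⟩
    unfold rotatedFrameOp tensorSelf
    simp only [ContinuousLinearMap.coe_coe, sum_apply,
      InnerProductSpace.rankOne_apply]
    exact Submodule.sum_mem _ fun i _ => Submodule.smul_mem _ _ (Subtype.property _)
  · unfold rotatedFrameOp tensorSelf
    rw [ContinuousLinearMap.toLinearMap_sum, map_sum]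
    push_cast
    refine Finset.sum_congr rfl fun i _ => ?_
    have hn : ‖(((V i : Op (tailSpan F)) (tailVec F i) : tailSpan F) : H)‖ = ‖tail F i‖ :=
      ContinuousLinearMap.norm_map_of_mem_unitary (V i).2 (tailVec F i)
    rw [InnerProductSpace.trace_rankOne, inner_self_eq_norm_sq_to_K, ← hF.2 i, hn]
    push_cast
    rfl

/-- The map `Ψ_F : U(R)^k → S_{F₀} + H_d(R)^τ`, where `R = span G` and `τ = ∑ a_i`, given by
`Ψ_F (U_1, …, U_k) = S_{F₀} + ∑ U_i f_i ⊗ U_i f_i`, the sum being over the vectors of `G`. -/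
def Psi {F₀ : Fin n₀ → H} {a : Fin k → ℝ} {F : Fin (n₀ + k) → H}
    (hF : F ∈ completions F₀ a) (V : Fin k → UGroup (tailSpan F)) :
    shiftedHermAffine (frameOp F₀) (tailSpan F) (∑ i, a i) :=
  ⟨frameOp F₀ + rotatedFrameOp F V, rotatedFrameOp F V, rotatedFrameOp_mem hF V, rfl⟩

/-- The model of the affine manifold `S₀ + H_d(R)^τ`. -/
abbrev modelS (S₀ : Op H) (R : Submodule ℂ H) (τ : ℝ) :=
  𝓘(ℝ, (shiftedHermAffine S₀ R τ).direction)

end FrameCompletion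

end

open FrameCompletion

/-! ### Local sections of analytic maps with surjective derivative -/

noncomputable section
-- In Cayley charts at `1`, the differential of `Psi` sends a tuple of skew-adjoint operators `X i`
-- on `R` to twice the sum of the operators `X i g_i ⊗ g_i + g_i ⊗ X i g_i`, where `g = tail F`; the
-- factor 2 is the derivative of the Cayley transform at 0. The question is whether these sums fill
-- the direction `D` of the target, i.e. the traceless self-adjoint operators with range in `R`.
-- This is decided by duality for the pairing `Re tr (T A)`, which is positive definite on
-- self-adjoint operators.
--
-- If they do not fill `D`, some nonzero `T` in `D` annihilates all of them. Testing against
-- directions `v ⟂ g_i` in `R` makes every `g_i` an eigenvector of `T`. Eigenvalues of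
-- non-orthogonal vectors agree, so irreducibility forces `T` to be a scalar on `R`, and trace zero
-- then gives `T = 0` (`eq_zero_of_trPairing_symRankOne`). Conversely, if `g` splits orthogonally,
-- the projection onto the span of one block annihilates the image of the differential but not all
-- of `D` (`exists_trPairing_symRankOne_eq_zero`).
--
-- The local section comes from the inverse function theorem, applied after restricting to an affine
-- slice complementary to the kernel of the differential. The neighbourhood in the image is the
-- domain of that section.
theorem ContDiffAt.exists_local_section {E E' : Type*} [NormedAddCommGroup E] [NormedSpace ℝ E]
    [NormedAddCommGroup E'] [NormedSpace ℝ E'] [FiniteDimensional ℝ E'] {f : E → E'}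
    {f' : E →L[ℝ] E'} {x : E} (hf : ContDiffAt ℝ ω f x) (hf' : HasFDerivAt f f' x)
    (hs : Function.Surjective f') {s : Set E} (hmem : s ∈ 𝓝 x) :
    ∃ (N : Set E') (g : E' → E), IsOpen N ∧ f x ∈ N ∧ ContDiffOn ℝ ω g N ∧ MapsTo g N s ∧
      (∀ y ∈ N, f (g y) = y) ∧ g (f x) = x := by
  obtain ⟨B, hB⟩ := (f' : E →ₗ[ℝ] E').exists_rightInverse_of_surjective
    (LinearMap.range_eq_top.2 hs)
  have : CompleteSpace E' := FiniteDimensional.complete ℝ E'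
  let b : E' →L[ℝ] E := LinearMap.toContinuousLinearMap B
  have hb : ∀ y, f' (b y) = y := fun y => LinearMap.congr_fun hB y
  -- The affine slice through `x` along a linear right inverse of `f'`: the composite `f ∘ h` has
  -- derivative the identity at 0, so it can be inverted locally, and `h` after that inverse is the
  -- section.
  let h : E' → E := fun y => x + b y
  have h0 : h 0 = x := by simp [h]
  have hh : ContDiff ℝ ω h := contDiff_const.add b.contDiff
  have hhd : HasFDerivAt h b 0 := b.hasFDerivAt.const_add x
  have hF : ContDiffAt ℝ ω (f ∘ h) 0 := ContDiffAt.comp 0 (by rwa [h0]) hh.contDiffAt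
  have hFd : HasFDerivAt (f ∘ h)
      ((ContinuousLinearEquiv.refl ℝ E' : E' ≃L[ℝ] E') : E' →L[ℝ] E') 0 := by
    have := HasFDerivAt.comp (g := f) (g' := f') 0 (by rwa [h0]) hhd
    convert this using 1
    ext y
    exact (hb y).symm
  have hω : (ω : WithTop ℕ∞) ≠ 0 := by simp
  let e := hF.toOpenPartialHomeomorph _ hFd hω
  have hF0 : (f ∘ h) 0 = f x := by simp [h0]
  have he0 : e.symm (f x) = 0 := hF0 ▸ hF.localInverse_apply_image hFd hω
  have hxe : f x ∈ e.target := hF0 ▸ hF.image_mem_toOpenPartialHomeomorph_target hFd hω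
  have hsm : ContDiffAt ℝ ω (h ∘ e.symm) (f x) :=
    hh.contDiffAt.comp _ (hF0 ▸ hF.to_localInverse hFd hω : ContDiffAt ℝ ω e.symm (f x))
  have hval : (h ∘ e.symm) (f x) = x := by simp [he0, h0]
  have hev : ∀ᶠ y in 𝓝 (f x), y ∈ e.target ∧ ContDiffAt ℝ ω (h ∘ e.symm) y ∧
      (h ∘ e.symm) y ∈ s := by
    refine Filter.Eventually.and (e.open_target.mem_nhds hxe) ((hsm.eventually (by simp)).and ?_)
    exact hsm.continuousAt.eventually_mem (by rwa [hval])
  obtain ⟨N, hN, hNo, hxN⟩ := eventually_nhds_iff.1 hev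
  exact ⟨N, h ∘ e.symm, hNo, hxN, fun y hy => (hN y hy).2.1.contDiffWithinAt,
    fun y hy => (hN y hy).2.2, fun y hy => e.right_inv (hN y hy).1, hval⟩

/-! ### Derivative of the Cayley transform at the origin -/

namespace UnitaryManifold

variable {A : Type*} [NormedRing A] [NormedAlgebra ℝ A]

theorem cayley_zero : cayley (0 : A) = 1 := by simp [cayley]

theorem hasFDerivAt_cayley_zero [CompleteSpace A] :
    HasFDerivAt (cayley : A → A) ((2 : ℝ) • ContinuousLinearMap.id ℝ A) 0 := by
  have h1 : HasFDerivAt (fun X : A => 1 + X) (ContinuousLinearMap.id ℝ A) 0 :=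
    (hasFDerivAt_id 0).const_add 1
  have h2 : HasFDerivAt (fun X : A => 1 - X) (-ContinuousLinearMap.id ℝ A) 0 :=
    (hasFDerivAt_id 0).const_sub 1
  have h3 := hasFDerivAt_ringInverse (𝕜 := ℝ) (1 : Aˣ)
  have h4 := HasFDerivAt.comp (g := (Ring.inverse : A → A)) 0 (by simpa using h3) h2
  have h5 := h1.mul' h4
  refine h5.congr_fderiv ?_
  ext X
  simp [two_smul]

end UnitaryManifold

/-! ### Rank one operators as real bilinear maps, and the tangent space of the target -/

namespace FrameCompletion

variable {H : Type*} [NormedAddCommGroup H] [InnerProductSpace ℂ H]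

/-- Conjugate-linearity in the second argument rules out complex bilinearity, so differentiation
takes place over `ℝ`. -/
theorem isBoundedBilinearMap_rankOne :
    IsBoundedBilinearMap ℝ fun p : H × H => (InnerProductSpace.rankOne ℂ p.1 p.2 : Op H) where
  add_left x y z := by simp
  smul_left c x y := by
    ext z
    simp only [InnerProductSpace.rankOne_apply, smul_apply]
    exact smul_comm _ _ _
  add_right x y z := by simp
  smul_right c x y := by
    ext z
    simp only [InnerProductSpace.rankOne_apply, smul_apply]
    rw [← Complex.coe_smul c y, inner_smul_left, Complex.conj_ofReal, mul_smul, Complex.coe_smul]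
  bound := ⟨1, one_pos, fun x y => by simp⟩

theorem contDiff_tensorSelf {n : WithTop ℕ∞} : ContDiff ℝ n (tensorSelf : H → Op H) :=
  ContDiff.comp (g := fun p : H × H => (InnerProductSpace.rankOne ℂ p.1 p.2 : Op H))
    isBoundedBilinearMap_rankOne.contDiff (contDiff_id.prodMk contDiff_id)

theorem hasFDerivAt_tensorSelf_comp {E : Type*} [NormedAddCommGroup E] [NormedSpace ℝ E]
    {f : E → H} {f' : E →L[ℝ] H} {x : E} (hf : HasFDerivAt f f' x) :
    HasFDerivAt (fun y => tensorSelf (f y))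
      ((isBoundedBilinearMap_rankOne.deriv (f x, f x)).comp (f'.prod f')) x :=
  HasFDerivAt.comp (g := fun p : H × H => (InnerProductSpace.rankOne ℂ p.1 p.2 : Op H))
    (f := fun y => (f y, f y)) x
    (isBoundedBilinearMap_rankOne.hasFDerivAt (f x, f x)) (hf.prodMk hf)

variable [FiniteDimensional ℂ H]

theorem mem_direction_shiftedHermAffine {S₀ T₀ : Op H} {R : Submodule ℂ H} {τ : ℝ}
    (h₀ : T₀ ∈ shiftedHermAffine S₀ R τ) {T : Op H} :
    T ∈ (shiftedHermAffine S₀ R τ).direction ↔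
      IsSelfAdjoint T ∧ T.range ≤ R ∧ LinearMap.trace ℂ H T = 0 := by
  obtain ⟨S, hS, rfl⟩ := h₀
  have h₀ : S₀ + S ∈ shiftedHermAffine S₀ R τ := ⟨S, hS, rfl⟩
  rw [← AffineSubspace.vadd_mem_iff_mem_direction T h₀]
  constructor
  · rintro ⟨S', hS', h⟩
    have hT : T = S' - S := by
      rw [vadd_eq_add] at h
      rw [eq_sub_iff_add_eq]
      apply add_left_cancel (a := S₀)
      rw [← h]; abel
    subst hT
    refine ⟨hS'.1.sub hS.1, ?_, ?_⟩
    · rintro _ ⟨x, rfl⟩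
      exact R.sub_mem (hS'.2.1 ⟨x, rfl⟩) (hS.2.1 ⟨x, rfl⟩)
    · rw [ContinuousLinearMap.toLinearMap_sub, map_sub, hS'.2.2, hS.2.2, sub_self]
  · rintro ⟨h1, h2, h3⟩
    refine ⟨T + S, ⟨h1.add hS.1, ?_, ?_⟩, by rw [vadd_eq_add]; abel⟩
    · rintro _ ⟨x, rfl⟩
      exact R.add_mem (h2 ⟨x, rfl⟩) (hS.2.1 ⟨x, rfl⟩)
    · rw [ContinuousLinearMap.toLinearMap_add, map_add, h3, hS.2.2, zero_add]

end FrameCompletion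

/-! ### Trace duality and irreducibility -/

namespace FrameCompletion

variable {H : Type*} [NormedAddCommGroup H] [InnerProductSpace ℂ H] [FiniteDimensional ℂ H]

/-- The symmetrized rank one operator `v ⊗ w + w ⊗ v`. -/
def symRankOne (v w : H) : Op H := InnerProductSpace.rankOne ℂ v w + InnerProductSpace.rankOne ℂ w v

/-- The real trace pairing `(T, A) ↦ Re tr (T A)`. -/
def trPairing : Op H →ₗ[ℝ] Op H →ₗ[ℝ] ℝ :=
  LinearMap.mk₂ ℝ (fun T A => (LinearMap.trace ℂ H (T * A : Op H)).re)
    (fun T T' A => by simp [add_mul])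
    (fun c T A => by
      rw [smul_mul_assoc, ← Complex.coe_smul c (T * A), ContinuousLinearMap.toLinearMap_smul,
        map_smul, smul_eq_mul, Complex.re_ofReal_mul, smul_eq_mul])
    (fun T A A' => by simp [mul_add])
    (fun c T A => by
      rw [mul_smul_comm, ← Complex.coe_smul c (T * A), ContinuousLinearMap.toLinearMap_smul,
        map_smul, smul_eq_mul, Complex.re_ofReal_mul, smul_eq_mul])

theorem trPairing_apply (T A : Op H) :
    trPairing T A = (LinearMap.trace ℂ H (T * A : Op H)).re := rfl

/-- For self-adjoint `T` the traces of the two rank one terms are complex conjugates, so their real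
parts add up. -/
theorem trPairing_symRankOne {T : Op H} (hT : IsSelfAdjoint T) (v w : H) :
    trPairing T (symRankOne v w) = 2 * (inner ℂ v (T w)).re := by
  have h : inner ℂ w (T v) = (starRingEnd ℂ) (inner ℂ v (T w)) := by
    rw [inner_conj_symm]
    exact (hT.isSymmetric w v).symm
  rw [trPairing_apply, symRankOne, mul_add, ContinuousLinearMap.mul_def,
    ContinuousLinearMap.mul_def, InnerProductSpace.comp_rankOne, InnerProductSpace.comp_rankOne,
    ContinuousLinearMap.toLinearMap_add, map_add, InnerProductSpace.trace_rankOne,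
    InnerProductSpace.trace_rankOne, h, Complex.add_re, Complex.conj_re, two_mul]

theorem trPairing_tensorSelf (T : Op H) (v : H) :
    trPairing T (tensorSelf v) = (inner ℂ v (T v)).re := by
  rw [trPairing_apply, tensorSelf, ContinuousLinearMap.mul_def, InnerProductSpace.comp_rankOne,
    InnerProductSpace.trace_rankOne]

/-- In an orthonormal basis, `tr (T * T)` is the sum of the `‖T b_i‖ ^ 2` because `T` is
self-adjoint. -/
theorem eq_zero_of_trPairing_self {T : Op H} (hT : IsSelfAdjoint T) (h : trPairing T T = 0) :
    T = 0 := by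
  let b := stdOrthonormalBasis ℂ H
  rw [trPairing_apply, LinearMap.trace_eq_sum_inner _ b, Complex.re_sum] at h
  have hi : ∀ i, (inner ℂ (b i) (((T * T : Op H) : H →ₗ[ℂ] H) (b i))).re = ‖T (b i)‖ ^ 2 := by
    intro i
    have : inner ℂ (b i) (T (T (b i))) = inner ℂ (T (b i)) (T (b i)) :=
      (hT.isSymmetric (b i) (T (b i))).symm
    change (inner ℂ (b i) (T (T (b i)))).re = _
    rw [this]
    exact inner_self_eq_norm_sq (𝕜 := ℂ) (T (b i))
  simp_rw [hi] at h
  rw [Finset.sum_eq_zero_iff_of_nonneg (fun _ _ => by positivity)] at h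
  apply ContinuousLinearMap.coe_injective
  refine b.toBasis.ext fun i => ?_
  simpa using h i (Finset.mem_univ i)

/-- Riesz representation inside `D`: definiteness makes `D` inject into its dual, and equality of
finite dimensions gives surjectivity. The representing operator lies in `D` itself. -/
theorem exists_trPairing_eq {D : Submodule ℝ (Op H)} (hD : ∀ T ∈ D, IsSelfAdjoint T)
    (f : D →ₗ[ℝ] ℝ) : ∃ T ∈ D, ∀ A : D, f A = trPairing T A := by
  have : FiniteDimensional ℝ (Op H) := FiniteDimensional.complexToReal (Op H)
  let Φ : D →ₗ[ℝ] Module.Dual ℝ D := (trPairing (H := H)).domRestrict₁₂ D D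
  have hinj : Function.Injective Φ := by
    rw [← LinearMap.ker_eq_bot, LinearMap.ker_eq_bot']
    intro T hT
    exact Subtype.ext (eq_zero_of_trPairing_self (hD T T.2) (LinearMap.congr_fun hT T))
  have hsurj : Function.Surjective Φ :=
    (LinearMap.injective_iff_surjective_of_finrank_eq_finrank
      (Subspace.dual_finrank_eq (K := ℝ) (V := D)).symm).1 hinj
  obtain ⟨T, hT⟩ := hsurj f
  exact ⟨T, T.2, fun A => by rw [← hT]; rfl⟩

variable {m : ℕ} {g : Fin m → H}

/-- The heart of the sufficiency of irreducibility: an annihilator `T` has every `g i` as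
eigenvector, irreducibility leaves a single eigenvalue, and the trace condition eliminates `T`. -/
theorem eq_zero_of_trPairing_symRankOne (hg : ∀ i, g i ≠ 0) (hirr : IsIrreducibleSeq g)
    {T : Op H} (hT : IsSelfAdjoint T) (hR : T.range ≤ Submodule.span ℂ (range g))
    (htr : LinearMap.trace ℂ H T = 0)
    (h : ∀ i, ∀ v ∈ Submodule.span ℂ (range g), inner ℂ (g i) v = 0 →
      trPairing T (symRankOne v (g i)) = 0) : T = 0 := by
  have hsym : ∀ x y, inner ℂ (T x) y = inner ℂ x (T y) := fun x y => hT.isSymmetric x y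
  have heig : ∀ i, ∃ c : ℂ, T (g i) = c • g i := by
    intro i
    have hne : (inner ℂ (g i) (g i) : ℂ) ≠ 0 := inner_self_ne_zero.2 (hg i)
    -- The Rayleigh quotient makes `v = T (g i) - c • g i` orthogonal to `g i`, hence an admissible
    -- test vector; its pairing with `T` is `2 * ‖v‖ ^ 2`.
    set c : ℂ := inner ℂ (g i) (T (g i)) / inner ℂ (g i) (g i) with hc
    refine ⟨c, ?_⟩
    have hv : inner ℂ (g i) (T (g i) - c • g i) = 0 := by
      rw [inner_sub_right, inner_smul_right, hc, div_mul_cancel₀ _ hne, sub_self]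
    have hmem : T (g i) - c • g i ∈ Submodule.span ℂ (range g) :=
      Submodule.sub_mem _ (hR ⟨g i, rfl⟩)
        (Submodule.smul_mem _ _ (Submodule.subset_span (mem_range_self i)))
    have h1 := h i _ hmem hv
    rw [trPairing_symRankOne hT] at h1
    have h2 : inner ℂ (T (g i) - c • g i) (T (g i)) =
        inner ℂ (T (g i) - c • g i) (T (g i) - c • g i) := by
      have h3 : inner ℂ (T (g i) - c • g i) (g i) = 0 := inner_eq_zero_symm.1 hv
      rw [inner_sub_right (T (g i) - c • g i) (T (g i)), inner_smul_right, h3, mul_zero, sub_zero]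
    rw [h2] at h1
    have h4 : ‖T (g i) - c • g i‖ ^ 2 = 0 := by
      have := inner_self_eq_norm_sq (𝕜 := ℂ) (T (g i) - c • g i)
      rw [← this]
      exact (mul_eq_zero.1 h1).resolve_left two_ne_zero
    exact sub_eq_zero.1 (norm_eq_zero.1 (pow_eq_zero_iff two_ne_zero |>.1 h4))
  choose c hc using heig
  have hconj : ∀ i j, (starRingEnd ℂ) (c i) * inner ℂ (g i) (g j) = c j * inner ℂ (g i) (g j) := by
    intro i j
    have := hsym (g i) (g j)
    rwa [hc, hc, inner_smul_left, inner_smul_right] at this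
  have hreal : ∀ i, (starRingEnd ℂ) (c i) = c i := fun i =>
    mul_right_cancel₀ (inner_self_ne_zero.2 (hg i)) (hconj i i)
  have hall : ∃ c₀ : ℂ, ∀ i, T (g i) = c₀ • g i := by
    rcases isEmpty_or_nonempty (Fin m) with he | ⟨⟨i₀⟩⟩
    · exact ⟨0, fun i => he.elim i⟩
    refine ⟨c i₀, fun i => ?_⟩
    by_contra hi
    -- Were there two eigenvalues, the indices with eigenvalue `c i₀` and the others would split `g`
    -- into nonempty orthogonal blocks.
    refine hirr ⟨{j | c j = c i₀}, ⟨i₀, rfl⟩, ⟨i, fun hi' => hi ?_⟩, ?_⟩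
    · rw [hc, show c i = c i₀ from hi']
    · intro j hj l hl
      by_contra hne
      have := mul_right_cancel₀ hne (hconj j l)
      rw [hreal] at this
      exact hl (this.symm.trans hj)
  obtain ⟨c₀, hc₀⟩ := hall
  have hspan : ∀ x ∈ Submodule.span ℂ (range g), T x = c₀ • x := by
    intro x hx
    induction hx using Submodule.span_induction with
    | mem x hx => obtain ⟨i, rfl⟩ := hx; exact hc₀ i
    | zero => simp
    | add x y _ _ hx hy => rw [map_add, hx, hy, smul_add]
    | smul a x _ hx => rw [map_smul, hx, smul_comm]
  -- `T` maps into the span, where it acts as `c₀`; hence the trace of `T * T` is `c₀` times the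
  -- trace of `T`, which is 0.
  have hTT : T * T = c₀ • T := by
    ext x
    exact hspan (T x) (hR ⟨x, rfl⟩)
  apply eq_zero_of_trPairing_self hT
  rw [trPairing_apply, hTT, ContinuousLinearMap.toLinearMap_smul, map_smul, htr, smul_zero,
    Complex.zero_re]

/-- A proper subspace `W` lies in the kernel of a nonzero functional. Its representing operator in
`D` is killed by the preceding rigidity result. -/
theorem le_of_symRankOne_mem (hg : ∀ i, g i ≠ 0) (hirr : IsIrreducibleSeq g)
    {D : Submodule ℝ (Op H)} (hD : ∀ T, T ∈ D ↔ IsSelfAdjoint T ∧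
      T.range ≤ Submodule.span ℂ (range g) ∧ LinearMap.trace ℂ H T = 0)
    {W : Submodule ℝ D}
    (hW : ∀ i, ∀ v ∈ Submodule.span ℂ (range g), inner ℂ (g i) v = 0 →
      ∃ A ∈ W, (A : Op H) = symRankOne v (g i)) : W = ⊤ := by
  by_contra hne
  obtain ⟨f, hf, hWf⟩ := W.exists_le_ker_of_lt_top (lt_top_iff_ne_top.2 hne)
  obtain ⟨T, hT, hfT⟩ := exists_trPairing_eq (fun T hT => ((hD T).1 hT).1) f
  have hT' := (hD T).1 hT
  have : T = 0 := by
    refine eq_zero_of_trPairing_symRankOne hg hirr hT'.1 hT'.2.1 hT'.2.2 fun i v hv hiv => ?_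
    obtain ⟨A, hA, hA'⟩ := hW i v hv hiv
    rw [← hA', ← hfT]
    exact hWf hA
  apply hf
  ext A
  rw [hfT, this]
  simp

/-- The witness `P` is the orthogonal projection onto the span of one block. It fixes or kills each
`g i`, so its pairing with `symRankOne v (g i)` is a multiple of `Re ⟨v, g i⟩`. `P` need not belong
to `D`. -/
theorem exists_trPairing_symRankOne_eq_zero (hg : ∀ i, g i ≠ 0) (hred : ¬ IsIrreducibleSeq g)
    {D : Submodule ℝ (Op H)} (hD : ∀ T, T ∈ D ↔ IsSelfAdjoint T ∧
      T.range ≤ Submodule.span ℂ (range g) ∧ LinearMap.trace ℂ H T = 0) :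
    ∃ P : Op H, (∀ i v, (inner ℂ v (g i)).re = 0 → trPairing P (symRankOne v (g i)) = 0) ∧
      ∃ A ∈ D, trPairing P A ≠ 0 := by
  obtain ⟨J, ⟨i, hi⟩, ⟨j, hj⟩, hJ⟩ := not_not.1 hred
  let K : Submodule ℂ H := Submodule.span ℂ (g '' J)
  have h1 : ∀ l ∈ J, K.starProjection (g l) = g l := fun l hl =>
    Submodule.starProjection_eq_self_iff.2 (Submodule.subset_span (mem_image_of_mem g hl))
  have h0 : ∀ l ∈ Jᶜ, K.starProjection (g l) = 0 := fun l hl => by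
    rw [Submodule.starProjection_apply_eq_zero_iff, Submodule.mem_orthogonal]
    intro u hu
    induction hu using Submodule.span_induction with
    | mem x hx => obtain ⟨n, hn, rfl⟩ := hx; exact hJ n hn l hl
    | zero => simp
    | add x y _ _ hx hy => rw [inner_add_left, hx, hy, add_zero]
    | smul a x _ hx => rw [inner_smul_left, hx, mul_zero]
  refine ⟨K.starProjection, ?_, ?_⟩
  · intro l v hv
    rw [trPairing_symRankOne (isSelfAdjoint_starProjection K)]
    by_cases hl : l ∈ J
    · rw [h1 l hl, hv, mul_zero]
    · rw [h0 l hl, inner_zero_right, Complex.zero_re, mul_zero]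
  · have hin : ∀ l, (‖g l‖ : ℂ) ≠ 0 := fun l => by simpa using hg l
    have hsa : ∀ l, IsSelfAdjoint (tensorSelf (g l)) := fun l =>
      (InnerProductSpace.isPositive_rankOne_self _).isSelfAdjoint
    have htr : ∀ l, LinearMap.trace ℂ H (tensorSelf (g l) : Op H) = (‖g l‖ : ℂ) ^ 2 := fun l => by
      rw [tensorSelf, InnerProductSpace.trace_rankOne, inner_self_eq_norm_sq_to_K]
      rfl
    have hmem : ∀ l x, tensorSelf (g l) x ∈ Submodule.span ℂ (range g) := fun l x =>
      Submodule.smul_mem _ _ (Submodule.subset_span (mem_range_self l))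
    -- The weights cancel the traces; `P` keeps only the first term, so the pairing equals `‖g j‖ ^
    -- 2 * ‖g i‖ ^ 2`.
    refine ⟨(‖g j‖ ^ 2 : ℝ) • tensorSelf (g i) - (‖g i‖ ^ 2 : ℝ) • tensorSelf (g j),
      (hD _).2 ⟨?_, ?_, ?_⟩, ?_⟩
    · exact ((IsSelfAdjoint.all _).smul (hsa i)).sub ((IsSelfAdjoint.all _).smul (hsa j))
    · rintro _ ⟨x, rfl⟩
      exact Submodule.sub_mem _ (Submodule.smul_of_tower_mem _ _ (hmem i x))
        (Submodule.smul_of_tower_mem _ _ (hmem j x))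
    · rw [← Complex.coe_smul, ← Complex.coe_smul, ContinuousLinearMap.toLinearMap_sub,
        ContinuousLinearMap.toLinearMap_smul, ContinuousLinearMap.toLinearMap_smul, map_sub,
        map_smul, map_smul, htr, htr]
      push_cast
      simp only [smul_eq_mul]
      ring
    · rw [map_sub, map_smul, map_smul, trPairing_tensorSelf, trPairing_tensorSelf, h1 i hi, h0 j hj,
        inner_zero_right, Complex.zero_re, smul_zero, sub_zero]
      have : (inner ℂ (g i) (g i)).re = ‖g i‖ ^ 2 := inner_self_eq_norm_sq (𝕜 := ℂ) (g i)
      rw [this, smul_eq_mul]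
      have a1 := norm_ne_zero_iff.2 (hg i)
      have a2 := norm_ne_zero_iff.2 (hg j)
      positivity

end FrameCompletion

/-! ### Transfer of local sections to manifolds -/

theorem exists_contMDiffOn_local_section {E E' H H' M N : Type*} [NormedAddCommGroup E]
    [NormedSpace ℝ E] [NormedAddCommGroup E'] [NormedSpace ℝ E'] [FiniteDimensional ℝ E']
    [TopologicalSpace H] [TopologicalSpace H'] [TopologicalSpace M] [ChartedSpace H M]
    [TopologicalSpace N] [ChartedSpace H' N] {I : ModelWithCorners ℝ E H}
    {J : ModelWithCorners ℝ E' H'} [IsManifold I ∞ M] [IsManifold J ∞ N] {f : M → N} {x : M}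
    (hI : range I = univ) (hsrc : (chartAt H' (f x)).source = univ) {f' : E →L[ℝ] E'}
    (hf : ContDiffAt ℝ ω (writtenInExtChartAt I J x f) (extChartAt I x x))
    (hf' : HasFDerivAt (writtenInExtChartAt I J x f) f' (extChartAt I x x))
    (hs : Function.Surjective f') :
    ∃ (U : Set N) (ψ : N → M), IsOpen U ∧ f x ∈ U ∧ ContMDiffOn J I ∞ ψ U ∧
      (∀ y ∈ U, f (ψ y) = y) ∧ ψ (f x) = x := by
  have htgt : (extChartAt I x).target ∈ 𝓝 (extChartAt I x x) := by
    have := extChartAt_target_mem_nhdsWithin (I := I) x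
    rwa [hI, nhdsWithin_univ] at this
  obtain ⟨W, σ, hWo, hxW, hσ, hmaps, hinv, hσx⟩ := hf.exists_local_section hf' hs htgt
  have hwx : writtenInExtChartAt I J x f (extChartAt I x x) = extChartAt J (f x) (f x) := by
    simp [writtenInExtChartAt]
  rw [hwx] at hxW hσx
  have hsrc' : (extChartAt J (f x)).source = univ := by rw [extChartAt_source, hsrc]
  have hcont : Continuous (extChartAt J (f x)) := by
    have := continuousOn_extChartAt (I := J) (f x)
    rwa [hsrc', continuousOn_univ] at this
  refine ⟨extChartAt J (f x) ⁻¹' W, fun y => (extChartAt I x).symm (σ (extChartAt J (f x) y)),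
    hWo.preimage hcont, hxW, ?_, ?_, ?_⟩
  · refine (contMDiffOn_extChartAt_symm x).comp (t := (extChartAt I x).target) ?_
      (fun y hy => hmaps hy)
    refine (ContDiffOn.contMDiffOn (hσ.of_le le_top)).comp (t := W) ?_ (fun y hy => hy)
    exact (contMDiffOn_extChartAt (x := f x)).mono (by rw [hsrc]; exact subset_univ _)
  -- The Euclidean section only gives equality of chart values; the chart of the target is global
  -- (`hsrc`), so its injectivity yields equality of points.
  · intro y hy
    have hmem : ∀ z, z ∈ (extChartAt J (f x)).source := fun z => by rw [hsrc']; trivial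
    exact (extChartAt J (f x)).injOn (hmem _) (hmem _) (hinv _ hy)
  · change (extChartAt I x).symm (σ (extChartAt J (f x) (f x))) = x
    rw [hσx, extChartAt_to_inv]

/-! ### Maps from tuples of unitaries to an affine subspace, in Cayley charts -/

namespace UnitaryManifold

variable {A E : Type*} [NormedRing A] [NormedAlgebra ℝ A] [CompleteSpace A] [StarRing A]
  [ContinuousStar A] [StarModule ℝ A] [NormedAddCommGroup E] [NormedSpace ℝ E]

theorem contDiffAt_cayley_comp (T : E →L[ℝ] A) : ContDiffAt ℝ ω (fun X => cayley (T X)) 0 :=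
  ContDiffAt.comp (g := (cayley : A → A)) 0 (contDiffAt_cayley (by simp)) T.contDiff.contDiffAt

theorem hasFDerivAt_cayley_comp (T : E →L[ℝ] A) :
    HasFDerivAt (fun X => cayley (T X)) ((2 : ℝ) • T) 0 := by
  have h : HasFDerivAt (cayley : A → A) ((2 : ℝ) • ContinuousLinearMap.id ℝ A) (T 0) := by
    rw [map_zero]; exact hasFDerivAt_cayley_zero
  exact h.comp 0 T.hasFDerivAt

section AffineValued

variable {ι : Type*} [Fintype ι] {V : Type*} [NormedAddCommGroup V] [NormedSpace ℝ V]
  {s : AffineSubspace ℝ V} {f : (ι → unitary A) → s} {G : (ι → A) → V}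

variable (ι A) in
/-- The model of the manifold of `ι`-tuples of unitary elements. -/
abbrev modelPow : ModelWithCorners ℝ (ι → LieAlg A) (ModelPi fun _ : ι => LieAlg A) :=
  ModelWithCorners.pi fun _ : ι => 𝓘(ℝ, LieAlg A)

variable (A) in
theorem range_modelPow : range (modelPow A ι) = univ := eq_univ_of_forall fun x => ⟨x, rfl⟩

theorem extChartAt_modelPow_self (U : ι → unitary A) : extChartAt (modelPow A ι) U U = 0 := by
  funext i
  change skewPart (cayleyInv (star (U i : A) * (U i : A))) = 0
  rw [Unitary.coe_star_mul_self, cayleyInv, sub_self, zero_mul, map_zero]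

variable (A) in
/-- The inclusion of tuples of skew-adjoint elements into tuples of elements. -/
def lieInclusion : (ι → LieAlg A) →L[ℝ] (ι → A) :=
  ContinuousLinearMap.pi fun i =>
    (skewAdjoint.submodule ℝ A).subtypeL.comp (ContinuousLinearMap.proj i)

/-- The inverse `X ↦ U c(X)` of the chart at `U`, `c` being the Cayley transform. -/
def cayleyTranslate (U : ι → unitary A) (X : ι → LieAlg A) : ι → A :=
  fun i => (U i : A) * cayley (X i : A)

theorem cayleyTranslate_zero (U : ι → unitary A) : cayleyTranslate U 0 = fun i => (U i : A) := by
  funext i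
  rw [cayleyTranslate, Pi.zero_apply, ZeroMemClass.coe_zero, cayley_zero, mul_one]

theorem contDiffAt_cayleyTranslate (U : ι → unitary A) :
    ContDiffAt ℝ ω (cayleyTranslate U) 0 := by
  rw [contDiffAt_pi]
  intro i
  have h := contDiffAt_cayley_comp (A := A) (E := ι → LieAlg A)
    ((ContinuousLinearMap.proj i).comp (lieInclusion A (ι := ι)))
  exact contDiffAt_const.mul h

theorem hasFDerivAt_cayleyTranslate_one :
    HasFDerivAt (cayleyTranslate (1 : ι → unitary A)) ((2 : ℝ) • lieInclusion A) 0 := by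
  refine (hasFDerivAt_pi' (𝕜 := ℝ) (E := ι → LieAlg A) (F' := fun _ : ι => A)
    (Φ := cayleyTranslate (1 : ι → unitary A))).2 ?_
  intro i
  have h := hasFDerivAt_cayley_comp (A := A) (E := ι → LieAlg A)
    ((ContinuousLinearMap.proj i).comp (lieInclusion A (ι := ι)))
  have hX : (fun X : ι → LieAlg A => cayleyTranslate (1 : ι → unitary A) X i) =
      fun X => cayley (((ContinuousLinearMap.proj i).comp (lieInclusion A (ι := ι))) X) := by
    funext X
    rw [cayleyTranslate, Pi.one_apply, OneMemClass.coe_one, one_mul]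
    rfl
  rw [hX]
  exact h

/-- The formula is claimed only near 0, since `cayleyUnitary` takes a default value where `1 - X` is
not invertible. -/
theorem coe_writtenInExtChartAt (hf : ∀ W, (f W : V) = G fun i => (W i : A))
    (U : ι → unitary A) :
    ∀ᶠ X in 𝓝 0, ((writtenInExtChartAt (modelPow A ι) 𝓘(ℝ, s.direction) U f X : s.direction) : V) =
      G (cayleyTranslate U X) - f U := by
  have hopen : ∀ i, ∀ᶠ X : ι → LieAlg A in 𝓝 0, IsUnit (1 - (X i : A)) := by
    intro i
    have hc : Continuous fun X : ι → LieAlg A => 1 - (X i : A) :=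
      continuous_const.sub (continuous_subtype_val.comp (continuous_apply i))
    exact (Units.isOpen.preimage hc).mem_nhds (by simp)
  filter_upwards [eventually_all.2 hopen] with X hX
  have h : (fun i => (((extChartAt (modelPow A ι) U).symm X i : unitary A) : A)) =
      cayleyTranslate U X := by
    funext i
    change ((U i * cayleyUnitary (X i) : unitary A) : A) = _
    rw [Submonoid.coe_mul, coe_cayleyUnitary (hX i), cayleyTranslate]
  rw [← h, ← hf]
  rfl

variable [FiniteDimensional ℝ V]

/-- A linear retraction onto the direction, through which smoothness of a `V`-valued expression
passes to the map with values in the subspace. -/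
theorem _root_.Submodule.exists_clm_apply_coe (D : Submodule ℝ V) :
    ∃ π : V →L[ℝ] D, ∀ x : D, π x = x := by
  obtain ⟨π, hπ⟩ := D.subtype.exists_leftInverse_of_injective D.ker_subtype
  exact ⟨LinearMap.toContinuousLinearMap π, fun x => LinearMap.congr_fun hπ x⟩

theorem contDiffAt_writtenInExtChartAt (hf : ∀ W, (f W : V) = G fun i => (W i : A))
    (hG : ContDiff ℝ ω G) (U : ι → unitary A) :
    ContDiffAt ℝ ω (writtenInExtChartAt (modelPow A ι) 𝓘(ℝ, s.direction) U f) 0 := by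
  obtain ⟨π, hπ⟩ := s.direction.exists_clm_apply_coe
  have h : ContDiffAt ℝ ω (fun X => π (G (cayleyTranslate U X) - f U)) 0 :=
    π.contDiff.contDiffAt.comp 0
      ((hG.contDiffAt.comp 0 (contDiffAt_cayleyTranslate U)).sub contDiffAt_const)
  refine h.congr_of_eventuallyEq ?_
  filter_upwards [coe_writtenInExtChartAt hf U] with X hX
  rw [← hX, hπ]

theorem exists_hasFDerivAt_writtenInExtChartAt (hf : ∀ W, (f W : V) = G fun i => (W i : A))
    (hG : ContDiff ℝ ω G) {G' : (ι → A) →L[ℝ] V} (hG' : HasFDerivAt G G' 1) :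
    ∃ L : (ι → LieAlg A) →L[ℝ] s.direction,
      HasFDerivAt (writtenInExtChartAt (modelPow A ι) 𝓘(ℝ, s.direction) 1 f) L 0 ∧
      ∀ X, (L X : V) = (2 : ℝ) • G' (fun i => (X i : A)) := by
  have hd := ((contDiffAt_writtenInExtChartAt hf hG 1).differentiableAt (by simp)).hasFDerivAt
  refine ⟨_, hd, fun X => ?_⟩
  have h1 := s.direction.subtypeL.hasFDerivAt.comp 0 hd
  have h2 : HasFDerivAt G G' (cayleyTranslate (1 : ι → unitary A) 0) := by
    rw [cayleyTranslate_zero]; exact hG'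
  have h3 := (h2.comp 0 hasFDerivAt_cayleyTranslate_one).sub_const (f 1 : V)
  -- The derivative is identified after inclusion into `V`, where the chain rule for `G` and the
  -- Cayley transform computes it.
  have h4 := h1.unique (h3.congr_of_eventuallyEq (coe_writtenInExtChartAt hf 1))
  have h5 := DFunLike.congr_fun h4 X
  have h6 : G' ((2 : ℝ) • lieInclusion A X) = (2 : ℝ) • G' (lieInclusion A X) := map_smul _ _ _
  exact h5.trans h6

theorem contMDiff_of_coe_eq (hf : ∀ W, (f W : V) = G fun i => (W i : A))
    (hG : ContDiff ℝ ω G) : ContMDiff (modelPow A ι) 𝓘(ℝ, s.direction) ∞ f := by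
  intro U
  rw [contMDiffAt_iff]
  constructor
  · apply Continuous.continuousAt
    rw [continuous_induced_rng]
    have : Subtype.val ∘ f = fun W => G fun i => (W i : A) := funext hf
    rw [this]
    exact hG.continuous.comp (by fun_prop)
  · rw [extChartAt_modelPow_self]
    exact ((contDiffAt_writtenInExtChartAt hf hG U).of_le le_top).contDiffWithinAt

theorem surjective_iff_of_coe_eq_two_smul {D : Submodule ℝ V} {G' : (ι → A) →L[ℝ] V}
    {L : (ι → LieAlg A) →L[ℝ] D} (hL : ∀ X, (L X : V) = (2 : ℝ) • G' (fun i => (X i : A))) :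
    Function.Surjective L ↔ ∀ B ∈ D, ∃ X : ι → LieAlg A, G' (fun i => (X i : A)) = B := by
  constructor
  · intro h B hB
    obtain ⟨X, hX⟩ := h ⟨B, hB⟩
    refine ⟨(2 : ℝ) • X, ?_⟩
    have h1 : (L X : V) = B := congrArg Subtype.val hX
    rw [← h1, hL, ← map_smul]
    rfl
  · intro h B
    obtain ⟨X, hX⟩ := h B B.2
    refine ⟨(2⁻¹ : ℝ) • X, Subtype.ext ?_⟩
    rw [map_smul, Submodule.coe_smul, hL, hX, smul_smul]
    norm_num

theorem isSubmersionAtPoint_one_iff (hf : ∀ W, (f W : V) = G fun i => (W i : A))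
    (hG : ContDiff ℝ ω G) {G' : (ι → A) →L[ℝ] V} (hG' : HasFDerivAt G G' 1) :
    IsSubmersionAtPoint (modelPow A ι) 𝓘(ℝ, s.direction) f 1 ↔
      ∀ B ∈ s.direction, ∃ X : ι → LieAlg A, G' (fun i => (X i : A)) = B := by
  obtain ⟨L, hL, hLX⟩ := exists_hasFDerivAt_writtenInExtChartAt hf hG hG'
  have hmd : MDifferentiableAt (modelPow A ι) 𝓘(ℝ, s.direction) f 1 :=
    (contMDiff_of_coe_eq hf hG).contMDiffAt.mdifferentiableAt (by simp)
  have hmf : HasMFDerivAt (modelPow A ι) 𝓘(ℝ, s.direction) f 1 L := by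
    refine ⟨hmd.continuousAt, ?_⟩
    rw [extChartAt_modelPow_self]
    exact hL.hasFDerivWithinAt
  rw [IsSubmersionAtPoint, hmf.mfderiv, and_iff_right hmd]
  exact surjective_iff_of_coe_eq_two_smul hLX

theorem exists_local_section_of_coe_eq (hf : ∀ W, (f W : V) = G fun i => (W i : A))
    (hG : ContDiff ℝ ω G) {G' : (ι → A) →L[ℝ] V} (hG' : HasFDerivAt G G' 1)
    (hs : ∀ B ∈ s.direction, ∃ X : ι → LieAlg A, G' (fun i => (X i : A)) = B) :
    ∃ (N : Set s) (ψ : s → (ι → unitary A)), IsOpen N ∧ f 1 ∈ N ∧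
      ContMDiffOn 𝓘(ℝ, s.direction) (modelPow A ι) ∞ ψ N ∧ (∀ S ∈ N, f (ψ S) = S) ∧
      ψ (f 1) = 1 := by
  obtain ⟨L, hL, hLX⟩ := exists_hasFDerivAt_writtenInExtChartAt hf hG hG'
  have hc := contDiffAt_writtenInExtChartAt hf hG 1
  rw [← extChartAt_modelPow_self (1 : ι → unitary A)] at hL hc
  have : IsManifold 𝓘(ℝ, LieAlg A) ∞ (unitary A) := IsManifold.of_le (n := ω) le_top
  have : IsManifold 𝓘(ℝ, s.direction) ∞ s := IsManifold.of_le (n := ω) le_top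
  have : IsManifold (modelPow A ι) ∞ (ι → unitary A) := instIsManifoldPi
  refine exists_contMDiffOn_local_section (range_modelPow A) rfl hc hL
    ((surjective_iff_of_coe_eq_two_smul hLX).2 hs)

end AffineValued

end UnitaryManifold

/-! ### Derivative of the frame operator, and the orbit directions of skew-adjoint operators -/

namespace FrameCompletion

variable {H : Type*} [NormedAddCommGroup H] [InnerProductSpace ℂ H]

theorem contDiff_const_add_sum_tensorSelf {k : ℕ} {E : Type*} [NormedAddCommGroup E]
    [NormedSpace ℝ E] (S₀ : Op H) (T : Fin k → E →L[ℝ] H) :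
    ContDiff ℝ ω fun X => S₀ + ∑ i, tensorSelf (T i X) :=
  contDiff_const.add (ContDiff.sum fun i _ => contDiff_tensorSelf.comp (T i).contDiff)

theorem exists_hasFDerivAt_const_add_sum_tensorSelf {k : ℕ} {E : Type*} [NormedAddCommGroup E]
    [NormedSpace ℝ E] (S₀ : Op H) (T : Fin k → E →L[ℝ] H) (x : E) :
    ∃ G' : E →L[ℝ] Op H, HasFDerivAt (fun X => S₀ + ∑ i, tensorSelf (T i X)) G' x ∧
      ∀ X, G' X = ∑ i, symRankOne (T i X) (T i x) := by
  refine ⟨_, (HasFDerivAt.fun_sum (u := Finset.univ) fun i _ =>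
    hasFDerivAt_tensorSelf_comp (T i).hasFDerivAt).const_add S₀, fun X => ?_⟩
  rw [sum_apply]
  refine Finset.sum_congr rfl fun i _ => ?_
  rw [symRankOne, add_comm]
  rfl

variable [FiniteDimensional ℂ H]

theorem re_inner_apply_self_of_mem_skewAdjoint {R : Submodule ℂ H} {X : Op R}
    (hX : X ∈ skewAdjoint (Op R))
    (g : R) : (inner ℂ ((X g : R) : H) (g : H)).re = 0 := by
  have h1 : ContinuousLinearMap.adjoint X = -X := skewAdjoint.mem_iff.1 hX
  have h2 : inner ℂ (X g) g = - inner ℂ g (X g) := by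
    rw [← ContinuousLinearMap.adjoint_inner_right, h1, neg_apply, inner_neg_right]
  have h3 : (inner ℂ (X g) g).re = (inner ℂ g (X g)).re := by
    rw [← inner_conj_symm, Complex.conj_re]
  have h4 := congrArg Complex.re h2
  rw [Complex.neg_re, ← h3] at h4
  change (inner ℂ (X g) g).re = 0
  linarith

/-- The normalized infinitesimal rotation in the plane of `g` and `v`; orthogonality removes its
second term at `g`. -/
theorem exists_skewAdjoint_apply_eq {R : Type*} [NormedAddCommGroup R] [InnerProductSpace ℂ R]
    [FiniteDimensional ℂ R] {g v : R} (hg : g ≠ 0) (hv : inner ℂ g v = 0) :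
    ∃ X ∈ skewAdjoint (Op R), X g = v := by
  have hne : (‖g‖ ^ 2 : ℝ) ≠ 0 := by positivity
  refine ⟨((‖g‖ ^ 2)⁻¹ : ℝ) • (InnerProductSpace.rankOne ℂ v g - InnerProductSpace.rankOne ℂ g v),
    ?_, ?_⟩
  · refine skewAdjoint.smul_mem _ ?_
    rw [skewAdjoint.mem_iff, star_sub, ContinuousLinearMap.star_eq_adjoint,
      ContinuousLinearMap.star_eq_adjoint, InnerProductSpace.adjoint_rankOne,
      InnerProductSpace.adjoint_rankOne, neg_sub]
  · have h : inner ℂ v g = 0 := inner_eq_zero_symm.1 hv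
    rw [smul_apply, sub_apply, InnerProductSpace.rankOne_apply, InnerProductSpace.rankOne_apply, h,
      zero_smul, sub_zero, inner_self_eq_norm_sq_to_K, ← Complex.coe_smul, smul_smul]
    have : (((‖g‖ ^ 2)⁻¹ : ℝ) : ℂ) * ((‖g‖ : ℂ)) ^ 2 = 1 := by
      rw [← Complex.ofReal_pow, ← Complex.ofReal_mul, inv_mul_cancel₀ hne, Complex.ofReal_one]
    exact (congrArg (· • v) this).trans (one_smul ℂ v)

end FrameCompletion

/-! ### Surjectivity of the differential of `Psi` and irreducibility -/

namespace FrameCompletion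

open UnitaryManifold

variable {H : Type*} [NormedAddCommGroup H] [InnerProductSpace ℂ H] [FiniteDimensional ℂ H]
variable {n₀ k : ℕ}

/-- Evaluation of the `i`-th of a tuple of operators on `R` at the vector `g i`. -/
def evalCoe {R : Submodule ℂ H} (g : Fin k → R) (i : Fin k) : (Fin k → Op R) →L[ℝ] H :=
  ((R.subtypeL.comp (ContinuousLinearMap.apply ℂ R (g i))).restrictScalars ℝ).comp
    (ContinuousLinearMap.proj i)

/-- The extension of `Psi` to tuples of operators on `R = span G`. -/
def psiExt (F₀ : Fin n₀ → H) (F : Fin (n₀ + k) → H) (T : Fin k → Op (tailSpan F)) : Op H :=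
  frameOp F₀ + ∑ i, tensorSelf (evalCoe (tailVec F) i T)

variable {F₀ : Fin n₀ → H} {a : Fin k → ℝ} {F : Fin (n₀ + k) → H}

theorem coe_Psi (hF : F ∈ completions F₀ a) (V : Fin k → UGroup (tailSpan F)) :
    (Psi hF V : Op H) = psiExt F₀ F fun i => (V i : Op (tailSpan F)) := rfl

theorem coe_Psi_one (hF : F ∈ completions F₀ a) : (Psi hF 1 : Op H) = frameOp F := by
  have h : (Psi hF 1 : Op H) = frameOp F₀ + ∑ i, tensorSelf (tail F i) := rfl
  rw [h, frameOp, frameOp, Fin.sum_univ_add]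
  simp_rw [hF.1]
  rfl

theorem tail_ne_zero (hdata : IsInitialData F₀ a) (hF : F ∈ completions F₀ a) (i : Fin k) :
    tail F i ≠ 0 := by
  intro h
  have h1 := hF.2 i
  have h2 := hdata.1 i
  rw [h, norm_zero] at h1
  norm_num at h1
  exact h2.ne h1

theorem forall_mem_direction_iff_isIrreducibleSeq (hdata : IsInitialData F₀ a)
    (hF : F ∈ completions F₀ a) {G' : (Fin k → Op (tailSpan F)) →L[ℝ] Op H}
    (hG' : ∀ X, G' X = ∑ i, symRankOne ((X i (tailVec F i) : tailSpan F) : H) (tail F i)) :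
    (∀ B ∈ (shiftedHermAffine (frameOp F₀) (tailSpan F) (∑ i, a i)).direction,
      ∃ X : Fin k → LieAlg (Op (tailSpan F)), G' (fun i => (X i : Op (tailSpan F))) = B) ↔
      IsIrreducibleSeq (tail F) := by
  set D := (shiftedHermAffine (frameOp F₀) (tailSpan F) (∑ i, a i)).direction with hDdef
  have hg := tail_ne_zero hdata hF
  have hD : ∀ T, T ∈ D ↔ IsSelfAdjoint T ∧ T.range ≤ Submodule.span ℂ (range (tail F)) ∧
      LinearMap.trace ℂ H T = 0 := fun T => mem_direction_shiftedHermAffine (Psi hF 1).2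
  constructor
  · intro h
    by_contra hred
    obtain ⟨P, hP, A, hA, hPA⟩ := exists_trPairing_symRankOne_eq_zero hg hred hD
    obtain ⟨X, hX⟩ := h A hA
    apply hPA
    rw [← hX, hG', map_sum]
    exact Finset.sum_eq_zero fun i _ =>
      hP i _ (re_inner_apply_self_of_mem_skewAdjoint (X i).2 (tailVec F i))
  · intro hirr B hB
    -- The part of the image of the differential lying in `D`; taking a preimage avoids showing that
    -- the whole image lies there.
    let W : Submodule ℝ D :=
      (LinearMap.range ((G' : (Fin k → Op (tailSpan F)) →ₗ[ℝ] Op H).comp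
        (lieInclusion (Op (tailSpan F)) (ι := Fin k) :
          (Fin k → LieAlg (Op (tailSpan F))) →ₗ[ℝ] (Fin k → Op (tailSpan F))))).comap D.subtype
    have hW : W = ⊤ := by
      refine le_of_symRankOne_mem hg hirr hD fun i v hv hiv => ?_
      have hne : tailVec F i ≠ 0 := fun h => hg i (congrArg Subtype.val h)
      obtain ⟨X, hX, hXv⟩ := exists_skewAdjoint_apply_eq (v := (⟨v, hv⟩ : tailSpan F)) hne hiv
      -- Moving only the `i`-th vector isolates a single symmetrized rank one operator.
      have hG : G' (Pi.single i X) = symRankOne v (tail F i) := by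
        rw [hG', Finset.sum_eq_single i]
        · rw [Pi.single_eq_same, hXv]
        · intro j _ hj
          rw [Pi.single_eq_of_ne hj]
          simp [symRankOne]
        · simp
      have hv' : inner ℂ v (tail F i) = 0 := inner_eq_zero_symm.1 hiv
      have hmem : symRankOne v (tail F i) ∈ D := by
        refine (hD _).2 ⟨?_, ?_, ?_⟩
        · rw [IsSelfAdjoint, symRankOne, star_add, ContinuousLinearMap.star_eq_adjoint,
            ContinuousLinearMap.star_eq_adjoint, InnerProductSpace.adjoint_rankOne,
            InnerProductSpace.adjoint_rankOne, add_comm]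
        · rintro _ ⟨x, rfl⟩
          exact Submodule.add_mem _ (Submodule.smul_mem _ _ hv)
            (Submodule.smul_mem _ _ (Submodule.subset_span (mem_range_self i)))
        · rw [symRankOne, ContinuousLinearMap.toLinearMap_add, map_add,
            InnerProductSpace.trace_rankOne, InnerProductSpace.trace_rankOne, hiv, hv', add_zero]
      refine ⟨⟨_, hmem⟩, ⟨Pi.single i ⟨X, hX⟩, ?_⟩, rfl⟩
      refine Eq.trans ?_ hG
      refine congrArg G' (funext fun j => ?_)
      change ((Pi.single i (⟨X, hX⟩ : LieAlg (Op (tailSpan F))) :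
        Fin k → LieAlg (Op (tailSpan F))) j : Op (tailSpan F)) = (Pi.single i X : Fin k → _) j
      by_cases hj : j = i
      · subst hj; simp
      · rw [Pi.single_eq_of_ne hj, Pi.single_eq_of_ne hj]; rfl
    have hBW : (⟨B, hB⟩ : D) ∈ W := hW ▸ Submodule.mem_top
    exact hBW

end FrameCompletion

end

theorem mainTheorem10 {H : Type*} [NormedAddCommGroup H] [InnerProductSpace ℂ H]
    [FiniteDimensional ℂ H] {n₀ k : ℕ} (F₀ : Fin n₀ → H) (a : Fin k → ℝ)
    (hdata : IsInitialData F₀ a) (F : Fin (n₀ + k) → H) (hF : F ∈ completions F₀ a) :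
    let I := modelU (tailSpan F) k
    let J := modelS (frameOp F₀) (tailSpan F) (∑ i, a i)
    ContMDiff I J ∞ (Psi hF) ∧
    (Psi hF 1 : Op H) = frameOp F ∧
    (IsSubmersionAtPoint I J (Psi hF) 1 ↔ IsIrreducibleSeq (tail F)) ∧
    (IsIrreducibleSeq (tail F) →
      range (Psi hF) ∈ 𝓝 (Psi hF 1) ∧
      ∃ (N : Set (shiftedHermAffine (frameOp F₀) (tailSpan F) (∑ i, a i)))
        (ψ : shiftedHermAffine (frameOp F₀) (tailSpan F) (∑ i, a i) →
          (Fin k → UGroup (tailSpan F))),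
        IsOpen N ∧ Psi hF 1 ∈ N ∧ ContMDiffOn J I ∞ ψ N ∧
        (∀ S ∈ N, Psi hF (ψ S) = S) ∧ ψ (Psi hF 1) = 1) := by
  intro I J
  have hfin : FiniteDimensional ℝ (Op H) := FiniteDimensional.complexToReal (Op H)
  have hG : ContDiff ℝ ω (psiExt F₀ F) := contDiff_const_add_sum_tensorSelf _ _
  obtain ⟨G', hG', hGX⟩ := exists_hasFDerivAt_const_add_sum_tensorSelf (frameOp F₀)
    (evalCoe (tailVec F)) 1
  have hiff := forall_mem_direction_iff_isIrreducibleSeq hdata hF (G' := G') hGX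
  refine ⟨UnitaryManifold.contMDiff_of_coe_eq (coe_Psi hF) hG, coe_Psi_one hF,
    (UnitaryManifold.isSubmersionAtPoint_one_iff (coe_Psi hF) hG hG').trans hiff, fun hirr => ?_⟩
  obtain ⟨N, ψ, hN, h1, hψ, hsec, hψ1⟩ :=
    UnitaryManifold.exists_local_section_of_coe_eq (coe_Psi hF) hG hG' (hiff.2 hirr)
  exact ⟨mem_of_superset (hN.mem_nhds h1) fun S hS => ⟨ψ S, hsec S hS⟩,
    N, ψ, hN, h1, hψ, hsec, hψ1⟩
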